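/- **Setting.** Let $\mathbb V$ be a finite non-empty set of individuals and let $W=[w_{ij}]$ be the weight matrix of a digraph on $\mathbb V$ without self-loops: $w_{ij}>0$ if $(i,j)$ is an edge and $w_{ij}=0$ otherwise. Let $s_i\in[0,1]$ be innate opinions, $\overline s=\max_i s_i$, $\underline s=\min_i s_i$, and let $\beta,\gamma$ be bias parameters with $$\beta\ge\gamma\ge0,\quad \beta>0,\quad 1-\max\{\|W\|_\infty,\|W\|_1\}\ge\max\{2\beta,4\gamma\},\quad W\text{ has a positive eigenvector},$$ where $\|W\|_\infty$ and $\|W\|_1$ are the maximal absolute row sum and the maximal absolute column sum. If Georgia holds the opinion $g\in[0,\underline s]$ and Hank the opinion $h\in[\overline s,1]$, the opinions evolve by $$x_i(k+1)=\alpha_i(x_i(k))s_i+\sum_j w_{ij}x_j(k)+\overline w(x_i(k))h+\underline w(x_i(k))g,$$ with $\overline w(x)=\beta-\gamma|x-h|$, $\underline w(x)=\beta-\gamma|x-g|$ and $\alpha_i(x)=1-\sum_j w_{ij}-\overline w(x)-\underline w(x)$. Let $\lambda$ be the largest modulus of an eigenvalue of $W$, let $c\ge0$, $c\ne0$, satisfy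 $W^\top c=\lambda c$, and put $\widehat c_i=c_i/\sum_j c_j$, $\widehat s=\sum_i\widehat c_is_i$, $\chi=\sum_i\widehat c_i\sum_j s_iw_{ij}$. Further let $$q(g,h)=(\beta+\gamma\widehat s-2\gamma h)(1-\lambda+\gamma g)+\big((1-2\beta-g\gamma)\widehat s-\chi+g\beta+g^2\gamma\big)\gamma+\gamma^2h^2,$$ $$m(g,h)=(\beta-\gamma\widehat s+2\gamma g)(1-\lambda-h\gamma)+g^2\gamma^2-\big((1-2\beta+h\gamma)\widehat s+h\beta-h^2\gamma-\chi\big)\gamma.$$ **Theorem 4 (influence).** For all $g\in[0,\underline s]$ and $h\in[\overline s,1]$ the opinions converge to a steady state $x^*(g,h)$ that is the same for all initial opinions in $[0,1]^{\mathbb V}$. The zero-sum game in which Georgia chooses $g\in[0,\underline s]$ to minimize $f(g,h)=c^\top x^*(g,h)$ and Hank chooses $h\in[\overline s,1]$ to maximize it has exactly one pure Nash equilibrium $(g^*,h^*)$, and the following hold. 1. If $\underline s>0$, then confirmation bias changes Georgia's equilibrium strategy, i.e. $g^*\ne0$, if and only if $$0<\frac{1-\lambda-2\gamma+2\widehat s\gamma}{2\widehat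 s-\lambda\widehat s-\gamma-\chi}<\frac{\gamma}{\beta}\le1.\tag{A}$$ 2. If $\overline s<1$, then confirmation bias changes Hank's equilibrium strategy, i.e. $h^*\ne1$, if and only if $$0<\frac{1-\lambda}{2-2\lambda-2\widehat s+\widehat s\lambda+2\beta\widehat s+\chi-\gamma}<\frac{\gamma}{\beta}\le1.\tag{B}$$ 3. Condition (A) is equivalent to $m(0,1)<0$, and condition (B) is equivalent to $q(0,1)<0$. (A condition whose fraction has denominator zero counts as not satisfied.) -/

import Mathlib

open Filter Topology

namespace OpinionGame

/-- A network of individuals `V` with two information sources (Hank and Georgia): an influence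
digraph without self-loops, influence weights `W` that are positive exactly on its edges and zero
elsewhere, innate opinions `s` in `[0, 1]`, and the bias parameters `β`, `γ`. -/
structure Network (V : Type*) where
  G : Digraph V
  loopless : ∀ i, ¬ G.Adj i i
  W : Matrix V V ℝ
  W_pos : ∀ i j, G.Adj i j → 0 < W i j
  W_zero : ∀ i j, ¬ G.Adj i j → W i j = 0
  s : V → ℝ
  s_mem : ∀ i, s i ∈ Set.Icc (0 : ℝ) 1
  β : ℝ
  γ : ℝ

noncomputable section

/-- The maximal absolute column sum of a matrix. -/
def colNorm {V : Type*} [Fintype V] [Nonempty V] (A : Matrix V V ℝ) : ℝ :=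
  Finset.univ.sup' Finset.univ_nonempty (fun j => ∑ i, |A i j|)

/-- The maximal absolute row sum of a matrix. -/
def rowNorm {V : Type*} [Fintype V] [Nonempty V] (A : Matrix V V ℝ) : ℝ :=
  Finset.univ.sup' Finset.univ_nonempty (fun i => ∑ j, |A i j|)

namespace Network

variable {V : Type*} [Fintype V] [DecidableEq V] [Nonempty V]

/-- The standing assumptions on the bias parameters and the influence weights. -/
structure Standing (N : Network V) : Prop where
  gamma_nonneg : 0 ≤ N.γ
  gamma_le_beta : N.γ ≤ N.β
  weights : max (2 * N.β) (4 * N.γ) ≤ 1 - max (rowNorm N.W) (colNorm N.W)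
  positive_eigenvector : ∃ v : V → ℝ, (∀ i, 0 < v i) ∧ ∃ μ : ℝ, N.W.mulVec v = μ • v

/-- The largest innate opinion. -/
def sMax (N : Network V) : ℝ := Finset.univ.sup' Finset.univ_nonempty N.s

/-- The smallest innate opinion. -/
def sMin (N : Network V) : ℝ := Finset.univ.inf' Finset.univ_nonempty N.s

/-- The weight of a source with opinion `o` on an individual with current opinion `x`. -/
def sourceWeight (N : Network V) (o x : ℝ) : ℝ := N.β - N.γ * |x - o|

/-- The resistance parameter of individual `i` with current opinion `x`: all the weights that act
on an individual sum to one. -/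
def resistance (N : Network V) (g h : ℝ) (i : V) (x : ℝ) : ℝ :=
  1 - ∑ j, N.W i j - N.sourceWeight h x - N.sourceWeight g x

/-- One step of the opinion dynamics, with Georgia's opinion `g` and Hank's opinion `h`. -/
def step (N : Network V) (g h : ℝ) (x : V → ℝ) : V → ℝ := fun i =>
  N.resistance g h i (x i) * N.s i + ∑ j, N.W i j * x j
    + N.sourceWeight h (x i) * h + N.sourceWeight g (x i) * g

/-- The opinions at time `k`, from the initial opinions `x₀`. -/
def opinion (N : Network V) (g h : ℝ) (x₀ : V → ℝ) (k : ℕ) : V → ℝ := (N.step g h)^[k] x₀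

/-- `x` is the steady state: the opinions converge to `x` from all initial opinions. -/
def IsSteadyState (N : Network V) (g h : ℝ) (x : V → ℝ) : Prop :=
  ∀ x₀ : V → ℝ, (∀ i, x₀ i ∈ Set.Icc (0 : ℝ) 1) → Tendsto (N.opinion g h x₀) atTop (𝓝 x)

/-- The steady state `x*(g, h)` (unique when it exists). -/
def steadyState (N : Network V) (g h : ℝ) : V → ℝ := Classical.epsilon (N.IsSteadyState g h)

/-- `λ`, the largest modulus of a complex eigenvalue of `W`. -/
def lam (N : Network V) : ℝ :=
  (spectralRadius ℂ (N.W.map (fun a : ℝ => (a : ℂ)))).toReal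

/-- `c` is an out-eigenvector centrality: a nonnegative nonzero eigenvector of the transpose of `W`
for the eigenvalue `λ`. -/
structure IsCentrality (N : Network V) (c : V → ℝ) : Prop where
  nonneg : ∀ i, 0 ≤ c i
  ne_zero : c ≠ 0
  eigen : N.W.transpose.mulVec c = N.lam • c

/-- The cost `f(g, h)`, the centrality-weighted steady-state opinion. -/
def cost (N : Network V) (c : V → ℝ) (g h : ℝ) : ℝ := ∑ i, c i * N.steadyState g h i

/-- `(g, h)` is a pure Nash equilibrium of the zero-sum game in which Georgia chooses
`g ∈ [0, sMin]` to minimize the cost and Hank chooses `h ∈ [sMax, 1]` to maximize it. -/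
structure IsNash (N : Network V) (c : V → ℝ) (g h : ℝ) : Prop where
  g_mem : g ∈ Set.Icc 0 N.sMin
  h_mem : h ∈ Set.Icc N.sMax 1
  georgia : ∀ g' ∈ Set.Icc 0 N.sMin, N.cost c g h ≤ N.cost c g' h
  hank : ∀ h' ∈ Set.Icc N.sMax 1, N.cost c g h' ≤ N.cost c g h

/-- The normalized centralities. -/
def cHat (c : V → ℝ) (i : V) : ℝ := c i / ∑ j, c j

/-- `ŝ`, the centrality-weighted average of the innate opinions. -/
def sHat (N : Network V) (c : V → ℝ) : ℝ := ∑ i, cHat c i * N.s i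

/-- `χ`, the weighted average of the influence-factored innate opinions. -/
def chi (N : Network V) (c : V → ℝ) : ℝ := ∑ i, cHat c i * ∑ j, N.s i * N.W i j

/-- The function `q`, the numerator of the derivative of the cost in `h`. -/
def q (N : Network V) (c : V → ℝ) (g h : ℝ) : ℝ :=
  (N.β + N.γ * N.sHat c - 2 * N.γ * h) * (1 - N.lam + N.γ * g)
    + ((1 - 2 * N.β - g * N.γ) * N.sHat c - N.chi c + g * N.β + g ^ 2 * N.γ) * N.γ
    + N.γ ^ 2 * h ^ 2

/-- The function `m`, the numerator of the derivative of the cost in `g`. -/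
def m (N : Network V) (c : V → ℝ) (g h : ℝ) : ℝ :=
  (N.β - N.γ * N.sHat c + 2 * N.γ * g) * (1 - N.lam - h * N.γ) + g ^ 2 * N.γ ^ 2
    - ((1 - 2 * N.β + h * N.γ) * N.sHat c + h * N.β - h ^ 2 * N.γ - N.chi c) * N.γ

/-- The threshold ratio for Georgia. -/
def ratioG (N : Network V) (c : V → ℝ) : ℝ :=
  (1 - N.lam - 2 * N.γ + 2 * N.sHat c * N.γ)
    / (2 * N.sHat c - N.lam * N.sHat c - N.γ - N.chi c)

/-- The threshold ratio for Hank. -/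
def ratioH (N : Network V) (c : V → ℝ) : ℝ :=
  (1 - N.lam)
    / (2 - 2 * N.lam - 2 * N.sHat c + N.sHat c * N.lam + 2 * N.β * N.sHat c + N.chi c - N.γ)

/-- The condition `0 < ratio < γ / β ≤ 1` for Georgia. -/
def CondG (N : Network V) (c : V → ℝ) : Prop :=
  0 < N.ratioG c ∧ N.ratioG c < N.γ / N.β ∧ N.γ / N.β ≤ 1

/-- The condition `0 < ratio < γ / β ≤ 1` for Hank. -/
def CondH (N : Network V) (c : V → ℝ) : Prop :=
  0 < N.ratioH c ∧ N.ratioH c < N.γ / N.β ∧ N.γ / N.β ≤ 1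

end Network

end

end OpinionGame

namespace OpinionGame

namespace Network

section

variable {V : Type*}

lemma W_nonneg (N : Network V) (i j : V) : 0 ≤ N.W i j := by
  by_cases h : N.G.Adj i j
  · exact (N.W_pos i j h).le
  · exact (N.W_zero i j h).ge

variable [Fintype V]

lemma step_eq_of_mem {N : Network V} {g h : ℝ} {x : V → ℝ} {i : V} (hx : x i ∈ Set.Icc g h) :
    N.step g h x i = (1 - ∑ j, N.W i j - 2 * N.β) * N.s i + ∑ j, N.W i j * x j
      + N.β * (h + g) + N.γ * ((h - g) * (x i + N.s i) - h ^ 2 + g ^ 2) := by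
  simp only [step, resistance, sourceWeight]
  rw [abs_of_nonneg (sub_nonneg.2 hx.1), abs_of_nonpos (sub_nonpos.2 hx.2)]
  ring

lemma sHat_eq (N : Network V) (c : V → ℝ) : N.sHat c = (∑ i, c i * N.s i) / ∑ i, c i := by
  simp only [sHat, cHat, Finset.sum_div]
  exact Finset.sum_congr rfl fun i _ => by ring

lemma chi_eq (N : Network V) (c : V → ℝ) :
    N.chi c = (∑ i, c i * (N.s i * ∑ j, N.W i j)) / ∑ i, c i := by
  simp only [chi, cHat, Finset.sum_div, ← Finset.mul_sum]
  exact Finset.sum_congr rfl fun i _ => by ring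

variable [Nonempty V]

lemma rowSum_le_rowNorm (N : Network V) (i : V) : ∑ j, N.W i j ≤ rowNorm N.W :=
  (Finset.sum_le_sum fun j _ => le_abs_self (N.W i j)).trans
    (Finset.le_sup' (fun i => ∑ j, |N.W i j|) (Finset.mem_univ i))

lemma sMin_le (N : Network V) (i : V) : N.sMin ≤ N.s i :=
  Finset.inf'_le N.s (Finset.mem_univ i)

lemma le_sMax (N : Network V) (i : V) : N.s i ≤ N.sMax :=
  Finset.le_sup' N.s (Finset.mem_univ i)

lemma sMin_nonneg (N : Network V) : 0 ≤ N.sMin :=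
  Finset.le_inf' _ _ fun i _ => (N.s_mem i).1

lemma sMax_le_one (N : Network V) : N.sMax ≤ 1 :=
  Finset.sup'_le _ _ fun i _ => (N.s_mem i).2

lemma Standing.rowNorm_le {N : Network V} (hN : N.Standing) :
    rowNorm N.W ≤ 1 - 2 * N.β ∧ rowNorm N.W ≤ 1 - 4 * N.γ := by
  have h := hN.weights
  have h1 := le_max_left (rowNorm N.W) (colNorm N.W)
  have h2 := le_max_left (2 * N.β) (4 * N.γ)
  have h3 := le_max_right (2 * N.β) (4 * N.γ)
  constructor <;> linarith

lemma dist_step_le {N : Network V} (hN : N.Standing) {g h : ℝ}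
    (hg : g ∈ Set.Icc 0 N.sMin) (hh : h ∈ Set.Icc N.sMax 1) (x y : V → ℝ) :
    dist (N.step g h x) (N.step g h y) ≤ (1 - 2 * N.β + N.γ) * dist x y := by
  have hK : 0 ≤ 1 - 2 * N.β + N.γ := by
    have h1 := Finset.sum_nonneg fun j (_ : j ∈ Finset.univ) =>
      N.W_nonneg (Classical.arbitrary V) j
    linarith [N.rowSum_le_rowNorm (Classical.arbitrary V), hN.rowNorm_le.1, hN.gamma_nonneg]
  refine (dist_pi_le_iff (by positivity)).2 fun i => ?_
  have hxy : ∀ j, |x j - y j| ≤ dist x y := fun j => by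
    rw [← Real.dist_eq]; exact dist_le_pi_dist x y j
  have hγ := hN.gamma_nonneg
  have hgs : 0 ≤ N.s i - g := by linarith [hg.2, N.sMin_le i]
  have hsh : 0 ≤ h - N.s i := by linarith [hh.1, N.le_sMax i]
  have hgh : h - g ≤ 1 := by linarith [hg.1, hh.2]
  have key : N.step g h x i - N.step g h y i
      = ∑ j, N.W i j * (x j - y j)
        + N.γ * ((N.s i - g) * (|x i - g| - |y i - g|)
          + (h - N.s i) * (|y i - h| - |x i - h|)) := by
    simp only [step, resistance, sourceWeight, mul_sub, Finset.sum_sub_distrib]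
    ring
  have h1 : |∑ j, N.W i j * (x j - y j)| ≤ (1 - 2 * N.β) * dist x y := by
    calc |∑ j, N.W i j * (x j - y j)| ≤ ∑ j, |N.W i j * (x j - y j)| :=
          Finset.abs_sum_le_sum_abs _ _
      _ ≤ ∑ j, N.W i j * dist x y := by
          refine Finset.sum_le_sum fun j _ => ?_
          rw [abs_mul, abs_of_nonneg (N.W_nonneg i j)]
          exact mul_le_mul_of_nonneg_left (hxy j) (N.W_nonneg i j)
      _ = (∑ j, N.W i j) * dist x y := by rw [Finset.sum_mul]
      _ ≤ (1 - 2 * N.β) * dist x y :=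
          mul_le_mul_of_nonneg_right ((N.rowSum_le_rowNorm i).trans hN.rowNorm_le.1) dist_nonneg
  have h2 : |(N.s i - g) * (|x i - g| - |y i - g|) + (h - N.s i) * (|y i - h| - |x i - h|)|
      ≤ dist x y := by
    have ha : abs (|x i - g| - |y i - g|) ≤ dist x y := by
      refine (abs_abs_sub_abs_le_abs_sub _ _).trans ?_
      simpa using hxy i
    have hb : abs (|y i - h| - |x i - h|) ≤ dist x y := by
      refine (abs_abs_sub_abs_le_abs_sub _ _).trans ?_
      simpa [abs_sub_comm] using hxy i
    calc _ ≤ (N.s i - g) * dist x y + (h - N.s i) * dist x y := by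
          refine (abs_add_le _ _).trans (add_le_add ?_ ?_)
          · rw [abs_mul, abs_of_nonneg hgs]
            exact mul_le_mul_of_nonneg_left ha hgs
          · rw [abs_mul, abs_of_nonneg hsh]
            exact mul_le_mul_of_nonneg_left hb hsh
      _ = (h - g) * dist x y := by ring
      _ ≤ dist x y := mul_le_of_le_one_left dist_nonneg hgh
  rw [Real.dist_eq, key]
  refine (abs_add_le _ _).trans ?_
  rw [abs_mul, abs_of_nonneg hγ]
  linarith [mul_le_mul_of_nonneg_left h2 hγ]

lemma step_mem_Icc {N : Network V} (hN : N.Standing) {g h : ℝ}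
    (hg : g ∈ Set.Icc 0 N.sMin) (hh : h ∈ Set.Icc N.sMax 1) {x : V → ℝ}
    (hx : ∀ i, x i ∈ Set.Icc g h) (i : V) : N.step g h x i ∈ Set.Icc g h := by
  have hγ := hN.gamma_nonneg
  have hγβ := hN.gamma_le_beta
  have hgs : 0 ≤ N.s i - g := by linarith [hg.2, N.sMin_le i]
  have hsh : 0 ≤ h - N.s i := by linarith [hh.1, N.le_sMax i]
  have hgh : h - g ≤ 1 := by linarith [hg.1, hh.2]
  have hxg : 0 ≤ x i - g := sub_nonneg.2 (hx i).1
  have hxh : 0 ≤ h - x i := sub_nonneg.2 (hx i).2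
  have hr : 0 ≤ 1 - ∑ j, N.W i j - 2 * N.β := by
    linarith [N.rowSum_le_rowNorm i, hN.rowNorm_le.1]
  have hW1 : (∑ j, N.W i j) * g ≤ ∑ j, N.W i j * x j := by
    rw [Finset.sum_mul]
    exact Finset.sum_le_sum fun j _ => mul_le_mul_of_nonneg_left (hx j).1 (N.W_nonneg i j)
  have hW2 : ∑ j, N.W i j * x j ≤ (∑ j, N.W i j) * h := by
    rw [Finset.sum_mul]
    exact Finset.sum_le_sum fun j _ => mul_le_mul_of_nonneg_left (hx j).2 (N.W_nonneg i j)
  have hwg : 0 ≤ N.β - N.γ * (x i - g) := by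
    nlinarith [mul_le_of_le_one_right hγ (show x i - g ≤ 1 by linarith)]
  have hwh : 0 ≤ N.β - N.γ * (h - x i) := by
    nlinarith [mul_le_of_le_one_right hγ (show h - x i ≤ 1 by linarith)]
  have hα : 0 ≤ 1 - ∑ j, N.W i j - 2 * N.β + N.γ * (h - g) :=
    add_nonneg hr (mul_nonneg hγ (by linarith))
  have p1 := mul_nonneg hα hgs
  have p2 := mul_nonneg hα hsh
  have p3 := mul_nonneg hwh (show 0 ≤ h - g by linarith)
  have p4 := mul_nonneg hwg (show 0 ≤ h - g by linarith)
  rw [step_eq_of_mem (hx i)]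
  constructor <;> nlinarith

lemma exists_isSteadyState {N : Network V} (hN : N.Standing) (hβ : 0 < N.β) {g h : ℝ}
    (hg : g ∈ Set.Icc 0 N.sMin) (hh : h ∈ Set.Icc N.sMax 1) :
    ∃ x : V → ℝ, (∀ i, x i ∈ Set.Icc g h) ∧ N.step g h x = x ∧ N.IsSteadyState g h x := by
  have hc : ContractingWith (Real.toNNReal (1 - 2 * N.β + N.γ)) (N.step g h) := by
    refine ⟨?_, LipschitzWith.of_dist_le' (dist_step_le hN hg hh)⟩
    rw [Real.toNNReal_lt_one]
    linarith [hN.gamma_le_beta]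
  have hgh : g ≤ h := hg.2.trans
    ((N.sMin_le (Classical.arbitrary V)).trans ((N.le_sMax _).trans hh.1))
  refine ⟨hc.fixedPoint, fun i => ?_, hc.fixedPoint_isFixedPt,
    fun x₀ _ => hc.tendsto_iterate_fixedPoint x₀⟩
  have hiter : ∀ k i, (N.step g h)^[k] (fun _ => g) i ∈ Set.Icc g h := by
    intro k
    induction k with
    | zero => exact fun _ => ⟨le_rfl, hgh⟩
    | succ k ih =>
      rw [Function.iterate_succ_apply']
      exact step_mem_Icc hN hg hh ih
  exact isClosed_Icc.mem_of_tendsto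
    (tendsto_pi_nhds.1 (hc.tendsto_iterate_fixedPoint fun _ => g) i)
    (Eventually.of_forall fun k => hiter k i)

lemma steadyState_spec {N : Network V} (hN : N.Standing) (hβ : 0 < N.β) {g h : ℝ}
    (hg : g ∈ Set.Icc 0 N.sMin) (hh : h ∈ Set.Icc N.sMax 1) :
    N.IsSteadyState g h (N.steadyState g h) ∧ (∀ i, N.steadyState g h i ∈ Set.Icc g h) ∧
      N.step g h (N.steadyState g h) = N.steadyState g h := by
  obtain ⟨x, hx, hfix, hs⟩ := exists_isSteadyState hN hβ hg hh
  have hs' : N.IsSteadyState g h (N.steadyState g h) := Classical.epsilon_spec ⟨x, hs⟩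
  have h0 : ∀ i : V, (fun _ : V => (0 : ℝ)) i ∈ Set.Icc (0 : ℝ) 1 := fun _ => by simp
  have : N.steadyState g h = x := tendsto_nhds_unique (hs' _ h0) (hs _ h0)
  exact ⟨hs', this ▸ hx, this ▸ hfix⟩

end

section

variable {V : Type*} [Fintype V] [DecidableEq V]

/-- The numerator of the normalized cost. -/
noncomputable def costNum (N : Network V) (c : V → ℝ) (g h : ℝ) : ℝ :=
  (1 - 2 * N.β) * N.sHat c - N.chi c + N.β * (h + g)
    + N.γ * ((h - g) * N.sHat c - h ^ 2 + g ^ 2)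

/-- The denominator of the normalized cost. -/
noncomputable def costDen (N : Network V) (g h : ℝ) : ℝ := 1 - N.lam - N.γ * (h - g)

lemma m_add_q (N : Network V) (c : V → ℝ) (g h : ℝ) :
    N.m c g h + N.q c g h = 2 * (N.β - N.γ * (h - g)) * N.costDen g h := by
  unfold m q costDen; ring

variable {N : Network V} {c : V → ℝ}

lemma IsCentrality.sum_pos (hc : N.IsCentrality c) : 0 < ∑ i, c i := by
  obtain ⟨i, hi⟩ := Function.ne_iff.1 hc.ne_zero
  exact Finset.sum_pos' (fun i _ => hc.nonneg i)
    ⟨i, Finset.mem_univ i, lt_of_le_of_ne (hc.nonneg i) (Ne.symm hi)⟩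

lemma IsCentrality.sum_mul_W (hc : N.IsCentrality c) (x : V → ℝ) :
    ∑ i, c i * ∑ j, N.W i j * x j = N.lam * ∑ i, c i * x i := by
  have h : ∀ j, ∑ i, N.W i j * c i = N.lam * c j := fun j => by
    simpa [Matrix.mulVec, dotProduct] using congrFun hc.eigen j
  simp_rw [Finset.mul_sum]
  rw [Finset.sum_comm]
  refine Finset.sum_congr rfl fun j _ => ?_
  rw [← mul_assoc, ← h j, Finset.sum_mul]
  exact Finset.sum_congr rfl fun i _ => by ring

lemma IsCentrality.sHat_nonneg (hc : N.IsCentrality c) : 0 ≤ N.sHat c := by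
  rw [sHat_eq]
  exact div_nonneg (Finset.sum_nonneg fun i _ => mul_nonneg (hc.nonneg i) (N.s_mem i).1)
    hc.sum_pos.le

variable [Nonempty V]

lemma IsCentrality.lam_le_rowNorm (hc : N.IsCentrality c) : N.lam ≤ rowNorm N.W := by
  have h := hc.sum_mul_W fun _ => 1
  simp only [mul_one] at h
  have h2 : ∑ i, c i * ∑ j, N.W i j ≤ ∑ i, c i * rowNorm N.W :=
    Finset.sum_le_sum fun i _ => mul_le_mul_of_nonneg_left (N.rowSum_le_rowNorm i) (hc.nonneg i)
  rw [h, ← Finset.sum_mul, mul_comm] at h2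
  exact le_of_mul_le_mul_left h2 hc.sum_pos

lemma costDen_pos (hN : N.Standing) (hβ : 0 < N.β) (hc : N.IsCentrality c) {g h : ℝ}
    (hg : 0 ≤ g) (hh : h ≤ 1) : 0 < N.costDen g h := by
  have h1 := mul_le_of_le_one_right hN.gamma_nonneg (show h - g ≤ 1 by linarith)
  unfold costDen
  linarith [hc.lam_le_rowNorm, hN.rowNorm_le.1, hN.gamma_le_beta]

lemma cost_eq (hN : N.Standing) (hβ : 0 < N.β) (hc : N.IsCentrality c) {g h : ℝ}
    (hg : g ∈ Set.Icc 0 N.sMin) (hh : h ∈ Set.Icc N.sMax 1) :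
    N.cost c g h = (∑ i, c i) * (N.costNum c g h / N.costDen g h) := by
  obtain ⟨-, hmem, hfix⟩ := steadyState_spec hN hβ hg hh
  have hD := costDen_pos hN hβ hc hg.1 hh.2
  have hS := hc.sum_pos
  set x := N.steadyState g h with hx
  have h1 : ∀ i, c i * x i = (1 - 2 * N.β + N.γ * (h - g)) * (c i * N.s i)
      - c i * (N.s i * ∑ j, N.W i j) + c i * ∑ j, N.W i j * x j
      + c i * (N.β * (h + g) + N.γ * (g ^ 2 - h ^ 2)) + N.γ * (h - g) * (c i * x i) := by
    intro i
    have h2 := congrFun hfix i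
    rw [step_eq_of_mem (hmem i)] at h2
    linear_combination -(c i) * h2
  have hsum := Finset.sum_congr rfl fun i (_ : i ∈ Finset.univ) => h1 i
  simp only [Finset.sum_add_distrib, Finset.sum_sub_distrib] at hsum
  rw [← Finset.mul_sum, ← Finset.mul_sum, ← Finset.sum_mul, hc.sum_mul_W] at hsum
  have hP : ∑ i, c i * N.s i = (∑ i, c i) * N.sHat c := by
    rw [sHat_eq]; field_simp
  have hQ : ∑ i, c i * (N.s i * ∑ j, N.W i j) = (∑ i, c i) * N.chi c := by
    rw [chi_eq]; field_simp
  rw [hP, hQ] at hsum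
  change ∑ i, c i * x i = _
  rw [← mul_div_assoc, eq_div_iff hD.ne']
  unfold costDen costNum
  linear_combination hsum

lemma cost_le_iff_georgia (hN : N.Standing) (hβ : 0 < N.β) (hc : N.IsCentrality c) {g g' h : ℝ}
    (hg : g ∈ Set.Icc 0 N.sMin) (hg' : g' ∈ Set.Icc 0 N.sMin) (hh : h ∈ Set.Icc N.sMax 1) :
    N.cost c g h ≤ N.cost c g' h ↔
      0 ≤ (g' - g) * (N.m c g h + N.γ * (g' - g) * N.costDen g h) := by
  have hD := costDen_pos hN hβ hc hg.1 hh.2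
  have hD' := costDen_pos hN hβ hc hg'.1 hh.2
  rw [cost_eq hN hβ hc hg hh, cost_eq hN hβ hc hg' hh, mul_le_mul_iff_right₀ hc.sum_pos,
    div_le_div_iff₀ hD hD', ← sub_nonneg]
  have : N.costNum c g' h * N.costDen g h - N.costNum c g h * N.costDen g' h
      = (g' - g) * (N.m c g h + N.γ * (g' - g) * N.costDen g h) := by
    unfold costNum costDen m; ring
  rw [this]

lemma cost_le_iff_hank (hN : N.Standing) (hβ : 0 < N.β) (hc : N.IsCentrality c) {g h h' : ℝ}
    (hg : g ∈ Set.Icc 0 N.sMin) (hh : h ∈ Set.Icc N.sMax 1) (hh' : h' ∈ Set.Icc N.sMax 1) :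
    N.cost c g h' ≤ N.cost c g h ↔
      0 ≤ (h - h') * (N.q c g h + N.γ * (h - h') * N.costDen g h) := by
  have hD := costDen_pos hN hβ hc hg.1 hh.2
  have hD' := costDen_pos hN hβ hc hg.1 hh'.2
  rw [cost_eq hN hβ hc hg hh, cost_eq hN hβ hc hg hh', mul_le_mul_iff_right₀ hc.sum_pos,
    div_le_div_iff₀ hD' hD, ← sub_nonneg]
  have : N.costNum c g h * N.costDen g h' - N.costNum c g h' * N.costDen g h
      = (h - h') * (N.q c g h + N.γ * (h - h') * N.costDen g h) := by
    unfold costNum costDen q; ring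
  rw [this]

lemma m_add_q_nonneg (hN : N.Standing) (hβ : 0 < N.β) (hc : N.IsCentrality c) {g h : ℝ}
    (hg : 0 ≤ g) (hh : h ≤ 1) : 0 ≤ N.m c g h + N.q c g h := by
  rw [m_add_q]
  have h1 := mul_le_of_le_one_right hN.gamma_nonneg (show h - g ≤ 1 by linarith)
  exact mul_nonneg (by linarith [hN.gamma_le_beta]) (costDen_pos hN hβ hc hg hh).le

/-- The quadratic optimality condition holds at two points only if they agree. -/
lemma eq_of_quadratic_conditions {a b M γ D : ℝ} (hγ : 0 ≤ γ) (hD : 0 < D)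
    (hM : γ = 0 → M ≠ 0) (hb : (b - a) * (M + γ * (b - a) * D) = 0)
    (hmid : 0 ≤ ((a + b) / 2 - a) * (M + γ * ((a + b) / 2 - a) * D)) : a = b := by
  by_contra hab
  have h0 : b - a ≠ 0 := sub_ne_zero.2 (Ne.symm hab)
  have hMe : M + γ * (b - a) * D = 0 := (mul_eq_zero.1 hb).resolve_left h0
  rcases hγ.eq_or_lt with h | h
  · subst h
    exact hM rfl (by simpa using hMe)
  · have : 0 < γ * (b - a) ^ 2 * D := by positivity
    nlinarith

lemma m_pos_of_gamma_eq_zero (hN : N.Standing) (hβ : 0 < N.β) (hc : N.IsCentrality c)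
    (h0 : N.γ = 0) (g h : ℝ) : 0 < N.m c g h := by
  have : 0 < 1 - N.lam := by linarith [hc.lam_le_rowNorm, hN.rowNorm_le.1]
  have h2 := mul_pos hβ this
  simpa [m, h0] using h2

lemma q_pos_of_gamma_eq_zero (hN : N.Standing) (hβ : 0 < N.β) (hc : N.IsCentrality c)
    (h0 : N.γ = 0) (g h : ℝ) : 0 < N.q c g h := by
  have : 0 < 1 - N.lam := by linarith [hc.lam_le_rowNorm, hN.rowNorm_le.1]
  have h2 := mul_pos hβ this
  simpa [q, h0] using h2

lemma IsNash.unique (hN : N.Standing) (hβ : 0 < N.β) (hc : N.IsCentrality c) {g h g' h' : ℝ}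
    (h1 : N.IsNash c g h) (h2 : N.IsNash c g' h') : g = g' ∧ h = h' := by
  have a1 := h1.georgia g' h2.g_mem
  have a2 := h1.hank h' h2.h_mem
  have a3 := h2.georgia g h1.g_mem
  have a4 := h2.hank h h1.h_mem
  constructor
  · have hge : N.cost c g' h ≤ N.cost c g h := by linarith
    have hmid : (g + g') / 2 ∈ Set.Icc 0 N.sMin :=
      ⟨by linarith [h1.g_mem.1, h2.g_mem.1], by linarith [h1.g_mem.2, h2.g_mem.2]⟩
    refine eq_of_quadratic_conditions hN.gamma_nonneg
      (costDen_pos hN hβ hc h1.g_mem.1 h1.h_mem.2)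
      (fun h0 => (m_pos_of_gamma_eq_zero hN hβ hc h0 g h).ne') (le_antisymm ?_ ?_)
      ((cost_le_iff_georgia hN hβ hc h1.g_mem hmid h1.h_mem).1 (h1.georgia _ hmid))
    · have e := (cost_le_iff_georgia hN hβ hc h2.g_mem h1.g_mem h1.h_mem).1 hge
      have : (g' - g) * (N.m c g h + N.γ * (g' - g) * N.costDen g h)
          = -((g - g') * (N.m c g' h + N.γ * (g - g') * N.costDen g' h)) := by
        unfold costDen m; ring
      linarith
    · exact (cost_le_iff_georgia hN hβ hc h1.g_mem h2.g_mem h1.h_mem).1 a1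
  · have hge : N.cost c g h ≤ N.cost c g h' := by linarith
    have hmid : (h + h') / 2 ∈ Set.Icc N.sMax 1 :=
      ⟨by linarith [h1.h_mem.1, h2.h_mem.1], by linarith [h1.h_mem.2, h2.h_mem.2]⟩
    have e1 := (cost_le_iff_hank hN hβ hc h1.g_mem h1.h_mem hmid).1 (h1.hank _ hmid)
    have e2 := (cost_le_iff_hank hN hβ hc h1.g_mem h1.h_mem h2.h_mem).1 a2
    refine eq_of_quadratic_conditions (M := -N.q c g h) hN.gamma_nonneg
      (costDen_pos hN hβ hc h1.g_mem.1 h1.h_mem.2)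
      (fun h0 => neg_ne_zero.2 (q_pos_of_gamma_eq_zero hN hβ hc h0 g h).ne')
      (le_antisymm ?_ ?_) ?_
    · have e := (cost_le_iff_hank hN hβ hc h1.g_mem h2.h_mem h1.h_mem).1 hge
      have : (h' - h) * (-N.q c g h + N.γ * (h' - h) * N.costDen g h)
          = -((h' - h) * (N.q c g h' + N.γ * (h' - h) * N.costDen g h')) := by
        unfold costDen q; ring
      linarith
    · linarith
    · linarith

lemma isNash_zero_one (hN : N.Standing) (hβ : 0 < N.β) (hc : N.IsCentrality c)
    (hm : 0 ≤ N.m c 0 1) (hq : 0 ≤ N.q c 0 1) : N.IsNash c 0 1 := by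
  have hg0 : (0 : ℝ) ∈ Set.Icc 0 N.sMin := ⟨le_rfl, N.sMin_nonneg⟩
  have hh1 : (1 : ℝ) ∈ Set.Icc N.sMax 1 := ⟨N.sMax_le_one, le_rfl⟩
  have hD := costDen_pos hN hβ hc (le_refl (0 : ℝ)) (le_refl (1 : ℝ))
  refine ⟨hg0, hh1, fun g' hg' => ?_, fun h' hh' => ?_⟩
  · rw [cost_le_iff_georgia hN hβ hc hg0 hg' hh1]
    have : 0 ≤ g' - 0 := sub_nonneg.2 hg'.1
    have := hN.gamma_nonneg
    positivity
  · rw [cost_le_iff_hank hN hβ hc hg0 hh1 hh']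
    have : 0 ≤ 1 - h' := sub_nonneg.2 hh'.2
    have := hN.gamma_nonneg
    positivity

lemma continuousOn_cost_georgia (hN : N.Standing) (hβ : 0 < N.β) (hc : N.IsCentrality c) {h : ℝ}
    (hh : h ∈ Set.Icc N.sMax 1) :
    ContinuousOn (fun g => N.cost c g h) (Set.Icc 0 N.sMin) := by
  refine ContinuousOn.congr (f := fun g => (∑ i, c i) * (N.costNum c g h / N.costDen g h)) ?_
    fun g hg => cost_eq hN hβ hc hg hh
  refine continuousOn_const.mul (ContinuousOn.div ?_ ?_ fun g hg =>
    (costDen_pos hN hβ hc hg.1 hh.2).ne')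
  · unfold costNum; fun_prop
  · unfold costDen; fun_prop

lemma continuousOn_cost_hank (hN : N.Standing) (hβ : 0 < N.β) (hc : N.IsCentrality c) {g : ℝ}
    (hg : g ∈ Set.Icc 0 N.sMin) :
    ContinuousOn (fun h => N.cost c g h) (Set.Icc N.sMax 1) := by
  refine ContinuousOn.congr (f := fun h => (∑ i, c i) * (N.costNum c g h / N.costDen g h)) ?_
    fun h hh => cost_eq hN hβ hc hg hh
  refine continuousOn_const.mul (ContinuousOn.div ?_ ?_ fun h hh =>
    (costDen_pos hN hβ hc hg.1 hh.2).ne')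
  · unfold costNum; fun_prop
  · unfold costDen; fun_prop

/-- If moving left from a minimizer, by any `t` up to some `a > 0`, changes the value by a positive
multiple of `-t * (M - K * t)`, then the slope `M` is nonpositive. -/
lemma nonpos_of_quadratic_conditions {a M K : ℝ} (ha : 0 < a) (hK : 0 ≤ K)
    (hM : ∀ t ∈ Set.Ioc 0 a, 0 ≤ -t * (M - K * t)) : M ≤ 0 := by
  by_contra! h
  have ht : 0 < min a (M / (K + 1) / 2) := by positivity
  set t := min a (M / (K + 1) / 2)
  have h1 := hM t ⟨ht, min_le_left _ _⟩
  have h2 : t * (2 * (K + 1)) ≤ M := by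
    rw [← le_div_iff₀ (by positivity)]
    refine (min_le_right _ _).trans (le_of_eq ?_)
    field_simp
  have h3 : 0 < M - K * t := by nlinarith
  nlinarith [mul_pos ht h3]

lemma exists_isNash_of_m_neg (hN : N.Standing) (hβ : 0 < N.β) (hc : N.IsCentrality c)
    (hm : N.m c 0 1 < 0) : ∃ g, N.IsNash c g 1 ∧ (0 < N.sMin → g ≠ 0) := by
  have hh1 : (1 : ℝ) ∈ Set.Icc N.sMax 1 := ⟨N.sMax_le_one, le_rfl⟩
  have hγ := hN.gamma_nonneg
  obtain ⟨g, hg, hmin⟩ := isCompact_Icc.exists_isMinOn (Set.nonempty_Icc.2 N.sMin_nonneg)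
    (continuousOn_cost_georgia hN hβ hc hh1)
  have hD := costDen_pos hN hβ hc hg.1 hh1.2
  have hmin' : ∀ g' ∈ Set.Icc 0 N.sMin,
      0 ≤ (g' - g) * (N.m c g 1 + N.γ * (g' - g) * N.costDen g 1) := fun g' hg' =>
    (cost_le_iff_georgia hN hβ hc hg hg' hh1).1 (hmin hg')
  have hmg : N.m c g 1 ≤ 0 := by
    rcases hg.1.eq_or_lt with h | h
    · rw [← h]; exact hm.le
    · refine nonpos_of_quadratic_conditions h (mul_nonneg hγ hD.le) fun t ht => ?_
      have := hmin' (g - t) ⟨by linarith [ht.2], by linarith [ht.1, hg.2]⟩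
      linarith
  have hq : 0 ≤ N.q c g 1 := by linarith [m_add_q_nonneg hN hβ hc hg.1 (le_refl (1 : ℝ))]
  refine ⟨g, ⟨hg, hh1, fun g' hg' => hmin hg', fun h' hh' => ?_⟩, ?_⟩
  · rw [cost_le_iff_hank hN hβ hc hg hh1 hh']
    have : 0 ≤ 1 - h' := sub_nonneg.2 hh'.2
    positivity
  · rintro hs rfl
    have := nonpos_of_quadratic_conditions (M := -N.m c 0 1) hs (mul_nonneg hγ hD.le)
      fun t ht => by
        have := hmin' t ⟨ht.1.le, ht.2⟩
        linarith
    linarith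

lemma exists_isNash_of_q_neg (hN : N.Standing) (hβ : 0 < N.β) (hc : N.IsCentrality c)
    (hq : N.q c 0 1 < 0) : ∃ h, N.IsNash c 0 h ∧ (N.sMax < 1 → h ≠ 1) := by
  have hg0 : (0 : ℝ) ∈ Set.Icc 0 N.sMin := ⟨le_rfl, N.sMin_nonneg⟩
  have hγ := hN.gamma_nonneg
  obtain ⟨h, hh, hmax⟩ := isCompact_Icc.exists_isMaxOn (Set.nonempty_Icc.2 N.sMax_le_one)
    (continuousOn_cost_hank hN hβ hc hg0)
  have hD := costDen_pos hN hβ hc hg0.1 hh.2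
  have hmax' : ∀ h' ∈ Set.Icc N.sMax 1,
      0 ≤ (h - h') * (N.q c 0 h + N.γ * (h - h') * N.costDen 0 h) := fun h' hh' =>
    (cost_le_iff_hank hN hβ hc hg0 hh hh').1 (hmax hh')
  have hqh : N.q c 0 h ≤ 0 := by
    rcases hh.2.eq_or_lt with e | e
    · rw [e]; exact hq.le
    · refine nonpos_of_quadratic_conditions (sub_pos.2 e) (mul_nonneg hγ hD.le) fun t ht => ?_
      have := hmax' (h + t) ⟨by linarith [ht.1, hh.1], by linarith [ht.2]⟩
      linarith
  have hm : 0 ≤ N.m c 0 h := by linarith [m_add_q_nonneg hN hβ hc (le_refl (0 : ℝ)) hh.2]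
  refine ⟨h, ⟨hg0, hh, fun g' hg' => ?_, fun h' hh' => hmax hh'⟩, ?_⟩
  · rw [cost_le_iff_georgia hN hβ hc hg0 hg' hh]
    have : 0 ≤ g' - 0 := sub_nonneg.2 hg'.1
    positivity
  · rintro hs rfl
    have := nonpos_of_quadratic_conditions (M := -N.q c 0 1) (sub_pos.2 hs)
      (mul_nonneg hγ hD.le) fun t ht => by
        have := hmax' (1 - t) ⟨by linarith [ht.2], by linarith [ht.1]⟩
        linarith
    linarith

lemma ratio_conditions_iff {a b β γ : ℝ} (ha : 0 < a) (hβ : 0 < β) (hγ : 0 ≤ γ) (hγβ : γ ≤ β) :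
    (0 < a / b ∧ a / b < γ / β ∧ γ / β ≤ 1) ↔ β * a - γ * b < 0 := by
  constructor
  · rintro ⟨h1, h2, -⟩
    have hb : 0 < b := (div_pos_iff_of_pos_left ha).1 h1
    rw [div_lt_div_iff₀ hb hβ] at h2
    linarith
  · intro h
    have hb : 0 < b := by
      by_contra! hb
      nlinarith [mul_pos hβ ha, mul_nonneg hγ (neg_nonneg.2 hb)]
    refine ⟨div_pos ha hb, ?_, (div_le_one hβ).2 hγβ⟩
    rw [div_lt_div_iff₀ hb hβ]
    linarith

lemma condG_iff (hN : N.Standing) (hβ : 0 < N.β) (hc : N.IsCentrality c) :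
    N.CondG c ↔ N.m c 0 1 < 0 := by
  have hγ := hN.gamma_nonneg
  have ha : 0 < 1 - N.lam - 2 * N.γ + 2 * N.sHat c * N.γ := by
    have := mul_nonneg hc.sHat_nonneg hγ
    linarith [hc.lam_le_rowNorm, hN.rowNorm_le.1, hN.rowNorm_le.2]
  rw [CondG, ratioG, ratio_conditions_iff ha hβ hγ hN.gamma_le_beta]
  refine iff_of_eq (congrArg (· < 0) ?_)
  unfold m; ring

lemma condH_iff (hN : N.Standing) (hβ : 0 < N.β) (hc : N.IsCentrality c) :
    N.CondH c ↔ N.q c 0 1 < 0 := by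
  have ha : 0 < 1 - N.lam := by linarith [hc.lam_le_rowNorm, hN.rowNorm_le.1]
  rw [CondH, ratioH, ratio_conditions_iff ha hβ hN.gamma_nonneg hN.gamma_le_beta]
  refine iff_of_eq (congrArg (· < 0) ?_)
  unfold q; ring

lemma exists_isNash_spec (hN : N.Standing) (hβ : 0 < N.β) (hc : N.IsCentrality c) :
    ∃ g h, N.IsNash c g h ∧ (0 < N.sMin → (g ≠ 0 ↔ N.m c 0 1 < 0)) ∧
      (N.sMax < 1 → (h ≠ 1 ↔ N.q c 0 1 < 0)) := by
  have hsum := m_add_q_nonneg hN hβ hc (le_refl (0 : ℝ)) (le_refl (1 : ℝ))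
  rcases lt_or_ge (N.m c 0 1) 0 with hm | hm
  · obtain ⟨g, hg, hg0⟩ := exists_isNash_of_m_neg hN hβ hc hm
    exact ⟨g, 1, hg, fun hs => iff_of_true (hg0 hs) hm,
      fun _ => iff_of_false (by simp) (by linarith)⟩
  · rcases lt_or_ge (N.q c 0 1) 0 with hq | hq
    · obtain ⟨h, hh, hh1⟩ := exists_isNash_of_q_neg hN hβ hc hq
      exact ⟨0, h, hh, fun _ => iff_of_false (by simp) (by linarith),
        fun hs => iff_of_true (hh1 hs) hq⟩
    · exact ⟨0, 1, isNash_zero_one hN hβ hc hm hq, fun _ => iff_of_false (by simp) (by linarith),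
        fun _ => iff_of_false (by simp) (by linarith)⟩

end

end Network

end OpinionGame

theorem theorem4 {V : Type*} [Fintype V] [DecidableEq V] [Nonempty V]
    (N : OpinionGame.Network V) (hN : N.Standing) (hβ : 0 < N.β)
    (c : V → ℝ) (hc : N.IsCentrality c) :
    -- the steady state, hence the cost of the game, is well defined
    (∀ g ∈ Set.Icc 0 N.sMin, ∀ h ∈ Set.Icc N.sMax 1, N.IsSteadyState g h (N.steadyState g h)) ∧
    -- there is exactly one pure Nash equilibrium
    (∃! p : ℝ × ℝ, N.IsNash c p.1 p.2) ∧
    -- when it differs from the equilibrium `(0, 1)` without confirmation bias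
    (∀ g h : ℝ, N.IsNash c g h →
      (0 < N.sMin → (g ≠ 0 ↔ N.CondG c)) ∧ (N.sMax < 1 → (h ≠ 1 ↔ N.CondH c))) ∧
    (N.CondG c ↔ N.m c 0 1 < 0) ∧
    (N.CondH c ↔ N.q c 0 1 < 0) := by
  have hG := OpinionGame.Network.condG_iff hN hβ hc
  have hH := OpinionGame.Network.condH_iff hN hβ hc
  obtain ⟨g₀, h₀, hNash, hg₀, hh₀⟩ := OpinionGame.Network.exists_isNash_spec hN hβ hc
  refine ⟨fun g hg h hh => (OpinionGame.Network.steadyState_spec hN hβ hg hh).1,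
    ⟨(g₀, h₀), hNash, ?_⟩, fun g h hgh => ?_, hG, hH⟩
  · rintro ⟨g, h⟩ hgh
    obtain ⟨rfl, rfl⟩ := hgh.unique hN hβ hc hNash
    rfl
  · obtain ⟨rfl, rfl⟩ := hgh.unique hN hβ hc hNash
    rw [hG, hH]
    exact ⟨hg₀, hh₀⟩
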